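/- Let $H$ be a complex Hilbert space of finite dimension $n$, and let $S,T$ be linear operators on $H$. For an operator $A$, let $A^*$ be its adjoint, $|A|=(A^*A)^{1/2}$, and let $s_1(A)\ge s_2(A)\ge\cdots$ be its singular values (the eigenvalues of $|A|$) in decreasing order, counted with multiplicity. For operators $A,B$ on $H$, let $A\oplus B=\begin{bmatrix}A&0\\0&B\end{bmatrix}$ on the Hilbert space $H\oplus H$. Let $f,g:[0,\infty)\to[0,\infty)$ be functions with $f(t)g(t)=t$ for all $t\ge 0$, and let $f(|A|)$, $g(|A|)$ be defined by the functional calculus of the self-adjoint operator $|A|$. Then for $j=1,\dots,n$ and for each choice of the sign $\pm$, $$s_j(S\pm \mathrm{i}T)\le s_j\Big(\big(g(|S^*|)+g(|T^*|)\big)\oplus\big(f(|S|)|S|+f(|T|)|T|\big)\Big).$$ In particular, for $j=1,\dots,n$ and for each choice of the sign $\pm$, $$s_j(S\pm \mathrm{i}T)\le s_j\Big(\big(|S^*|+|T^*|\big)\oplus\big(|S|+|T|\big)\Big).$$ -/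

import Mathlib

open scoped NNReal

noncomputable section

namespace SingularSum

variable {E : Type*} [NormedAddCommGroup E] [InnerProductSpace ℂ E]

/-- The operator `A ⊕ B`, i.e. `(x, y) ↦ (A x, B y)`, on the Hilbert space direct sum of two copies
of `E`, whose norm is `‖(x, y)‖ = √(‖x‖² + ‖y‖²)`. -/
def directSum (A B : E →L[ℂ] E) : WithLp 2 (E × E) →L[ℂ] WithLp 2 (E × E) :=
  ((WithLp.prodContinuousLinearEquiv 2 ℂ E E).symm : E × E →L[ℂ] WithLp 2 (E × E)) ∘L
    A.prodMap B ∘L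
      ((WithLp.prodContinuousLinearEquiv 2 ℂ E E) : WithLp 2 (E × E) →L[ℂ] E × E)

/-- The `j`-th largest singular value of `A`, counted with multiplicity and indexed from `j = 1`
(Mathlib's sequence of singular values starts at index `0`). -/
def s [FiniteDimensional ℂ E] (j : ℕ) (A : E →L[ℂ] E) : ℝ :=
  (A : E →ₗ[ℂ] E).singularValues (j - 1)

end SingularSum

end

/-! Everything reduces to one form inequality, 2 Re⟨x, Xy⟩ ≤ ⟨x, Ax⟩ + ⟨y, By⟩. For X = S it comes
from a factorization S = (SR)K with K² = f(|S|)|S| and (SR)(SR)* ≤ g(|S*|), by Cauchy–Schwarz and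
AM–GM (`two_mul_re_inner_le_of_mul_eq`); adding the one for T gives X = S ± iT. Min-max then passes
from forms to singular values (`s_le_s_directSum`). -/

/-! ### Singular values and min-max -/

theorem LinearMap.norm_sq_apply_eq_sum_eigenvalues {𝕜 E F : Type*} [RCLike 𝕜]
    [NormedAddCommGroup E] [InnerProductSpace 𝕜 E] [FiniteDimensional 𝕜 E]
    [NormedAddCommGroup F] [InnerProductSpace 𝕜 F] [FiniteDimensional 𝕜 F]
    (M : E →ₗ[𝕜] F) {n : ℕ} (hn : Module.finrank 𝕜 E = n) (w : E) :
    ‖M w‖ ^ 2 = ∑ i, M.isSymmetric_adjoint_comp_self.eigenvalues hn i *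
      ‖inner 𝕜 (M.isSymmetric_adjoint_comp_self.eigenvectorBasis hn i) w‖ ^ 2 := by
  set hM := M.isSymmetric_adjoint_comp_self
  set b := hM.eigenvectorBasis hn
  have h1 : inner 𝕜 w ((M.adjoint ∘ₗ M) w) = ((‖M w‖ : 𝕜)) ^ 2 := by
    rw [LinearMap.comp_apply, LinearMap.adjoint_inner_right, inner_self_eq_norm_sq_to_K]
  have h2 : ((‖M w‖ ^ 2 : ℝ) : 𝕜) = ((∑ i, hM.eigenvalues hn i * ‖inner 𝕜 (b i) w‖ ^ 2 : ℝ) : 𝕜) := by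
    push_cast
    rw [← h1, ← b.sum_inner_mul_inner]
    refine Finset.sum_congr rfl fun i _ ↦ ?_
    rw [← hM (b i) w, hM.apply_eigenvectorBasis, inner_smul_left, RCLike.conj_ofReal,
      mul_left_comm, ← inner_conj_symm, RCLike.conj_mul]
  exact_mod_cast h2

/-- The easy half of min-max: by dimension, W contains a nonzero vector orthogonal to the top k
right singular vectors, and M stretches it by at most its singular value of index k (from 0). -/
theorem LinearMap.le_singularValues_of_finrank_lt {𝕜 E F : Type*} [RCLike 𝕜]
    [NormedAddCommGroup E] [InnerProductSpace 𝕜 E] [FiniteDimensional 𝕜 E]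
    [NormedAddCommGroup F] [InnerProductSpace 𝕜 F] [FiniteDimensional 𝕜 F]
    (M : E →ₗ[𝕜] F) (W : Submodule 𝕜 E) {k : ℕ} (hk : k < Module.finrank 𝕜 W) {c : ℝ}
    (h : ∀ w ∈ W, c * ‖w‖ ≤ ‖M w‖) : c ≤ M.singularValues k := by
  by_contra! hc
  have hkn : k < Module.finrank 𝕜 E := hk.trans_le W.finrank_le
  set hM := M.isSymmetric_adjoint_comp_self
  set b := hM.eigenvectorBasis rfl
  let φ : W →ₗ[𝕜] (Fin k → 𝕜) :=
    LinearMap.pi fun i ↦ (innerₛₗ 𝕜 (b (Fin.castLE hkn.le i))) ∘ₗ W.subtype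
  obtain ⟨w, hw, hw0⟩ := (Submodule.ne_bot_iff _).1
    (LinearMap.ker_ne_bot_of_finrank_lt (f := φ) (by simpa using hk))
  have hz : ∀ i : Fin (Module.finrank 𝕜 E), (i : ℕ) < k → inner 𝕜 (b i) (w : E) = 0 := by
    intro i hi
    have := congrFun (LinearMap.mem_ker.1 hw) ⟨i, hi⟩
    simpa [φ] using this
  have hle : ‖M w‖ ^ 2 ≤ M.singularValues k ^ 2 * ‖(w : E)‖ ^ 2 := by
    rw [LinearMap.norm_sq_apply_eq_sum_eigenvalues M rfl, ← b.sum_sq_norm_inner_right,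
      Finset.mul_sum]
    refine Finset.sum_le_sum fun i _ ↦ ?_
    rcases lt_or_ge (i : ℕ) k with hi | hi
    · have := hz i hi
      simp only [b] at this
      simp [b, this]
    · refine mul_le_mul_of_nonneg_right ?_ (by positivity)
      rw [M.sq_singularValues_of_lt rfl hkn]
      exact M.isSymmetric_adjoint_comp_self.eigenvalues_antitone rfl hi
  have hpos : 0 < ‖(w : E)‖ := by simpa using hw0
  have h0 := M.singularValues_nonneg k
  have h1 := h w w.2
  have h2 : ‖M w‖ ≤ M.singularValues k * ‖(w : E)‖ :=
    le_of_sq_le_sq (by rwa [mul_pow]) (by positivity)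
  nlinarith

theorem LinearMap.exists_orthonormal_singularValues {𝕜 E F : Type*} [RCLike 𝕜]
    [NormedAddCommGroup E] [InnerProductSpace 𝕜 E] [FiniteDimensional 𝕜 E]
    [NormedAddCommGroup F] [InnerProductSpace 𝕜 F] [FiniteDimensional 𝕜 F]
    (M : E →ₗ[𝕜] F) {k : ℕ} (hk : 0 < M.singularValues k) :
    ∃ (v : Fin (k + 1) → E) (u : Fin (k + 1) → F), Orthonormal 𝕜 v ∧ Orthonormal 𝕜 u ∧
      ∀ i, M (v i) = (M.singularValues i : 𝕜) • u i := by
  have hkn : k + 1 ≤ Module.finrank 𝕜 E := by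
    by_contra! h
    exact hk.ne' (M.singularValues_of_finrank_le (by omega))
  set hM := M.isSymmetric_adjoint_comp_self
  set b := hM.eigenvectorBasis rfl
  have hσ : ∀ i : Fin (k + 1), (M.singularValues i : 𝕜) ≠ 0 := fun i ↦
    RCLike.ofReal_ne_zero.2 (hk.trans_le (M.singularValues_antitone (by omega))).ne'
  have hv : Orthonormal 𝕜 fun i : Fin (k + 1) ↦ b (Fin.castLE hkn i) :=
    b.orthonormal.comp _ (Fin.castLE_injective hkn)
  refine ⟨fun i ↦ b (Fin.castLE hkn i),
    fun i ↦ (M.singularValues i : 𝕜)⁻¹ • M (b (Fin.castLE hkn i)), hv, ?_, fun i ↦ ?_⟩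
  · rw [orthonormal_iff_ite] at hv ⊢
    intro i j
    have h := hv i j
    have he : (M.adjoint ∘ₗ M) (b (Fin.castLE hkn j)) =
        (M.singularValues j : 𝕜) ^ 2 • b (Fin.castLE hkn j) := by
      rw [hM.apply_eigenvectorBasis, ← RCLike.ofReal_pow]
      congr 2
      exact (M.sq_singularValues_fin rfl (Fin.castLE hkn j)).symm
    rw [inner_smul_left, inner_smul_right, ← LinearMap.adjoint_inner_right,
      ← LinearMap.comp_apply, he, inner_smul_right, h, map_inv₀, RCLike.conj_ofReal]
    split_ifs with hij
    · subst hij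
      field_simp [hσ i]
    · simp
  · rw [smul_smul, mul_inv_cancel₀ (hσ i), one_smul]

/-- With singular vectors Xvᵢ = σᵢuᵢ, i ≤ k, test on the (k+1)-dimensional space of w = (∑ cᵢuᵢ, ∑
cᵢvᵢ). There ‖w‖² = 2∑|cᵢ|², so the hypothesis bounds the form of A ⊕ B below by σₖ‖w‖², and
Cauchy–Schwarz turns this into a norm bound. -/
theorem SingularSum.s_le_s_directSum {E : Type*} [NormedAddCommGroup E] [InnerProductSpace ℂ E]
    [FiniteDimensional ℂ E] {X A B : E →L[ℂ] E}
    (h : ∀ x y, 2 * (inner ℂ x (X y)).re ≤ (inner ℂ x (A x)).re + (inner ℂ y (B y)).re) (j : ℕ) :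
    SingularSum.s j X ≤ SingularSum.s j (SingularSum.directSum A B) := by
  unfold SingularSum.s
  generalize j - 1 = k
  rcases (LinearMap.singularValues_nonneg (X : E →ₗ[ℂ] E) k).eq_or_lt with h0 | h0
  · rw [← h0]
    exact LinearMap.singularValues_nonneg _ _
  obtain ⟨v, u, hv, hu, hX⟩ := LinearMap.exists_orthonormal_singularValues _ h0
  let P : (Fin (k + 1) → ℂ) →ₗ[ℂ] E := Fintype.linearCombination ℂ u
  let Q : (Fin (k + 1) → ℂ) →ₗ[ℂ] E := Fintype.linearCombination ℂ v
  let L : (Fin (k + 1) → ℂ) →ₗ[ℂ] WithLp 2 (E × E) :=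
    (WithLp.linearEquiv 2 ℂ (E × E)).symm.toLinearMap ∘ₗ P.prod Q
  have hP : ∀ c, ‖P c‖ ^ 2 = ∑ i, ‖c i‖ ^ 2 := by
    intro c
    have := hu.inner_sum c c Finset.univ
    rw [inner_self_eq_norm_sq_to_K] at this
    simp only [RCLike.conj_mul] at this
    exact_mod_cast this
  have hQ : ∀ c, ‖Q c‖ ^ 2 = ∑ i, ‖c i‖ ^ 2 := by
    intro c
    have := hv.inner_sum c c Finset.univ
    rw [inner_self_eq_norm_sq_to_K] at this
    simp only [RCLike.conj_mul] at this
    exact_mod_cast this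
  have hL : ∀ c, ‖L c‖ ^ 2 = 2 * ∑ i, ‖c i‖ ^ 2 := by
    intro c
    rw [WithLp.prod_norm_sq_eq_of_L2]
    change ‖P c‖ ^ 2 + ‖Q c‖ ^ 2 = _
    rw [hP, hQ, two_mul]
  have hinj : Function.Injective L := by
    rw [injective_iff_map_eq_zero]
    intro c hc
    have h1 := hL c
    rw [hc, norm_zero, eq_comm, zero_pow two_ne_zero, mul_eq_zero_iff_left two_ne_zero,
      Finset.sum_eq_zero_iff_of_nonneg fun _ _ ↦ by positivity] at h1
    funext i
    simpa using h1 i (Finset.mem_univ i)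
  refine LinearMap.le_singularValues_of_finrank_lt _ (LinearMap.range L) ?_ ?_
  · rw [LinearMap.finrank_range_of_inj hinj]
    simp
  rintro _ ⟨c, rfl⟩
  set σ := (X : E →ₗ[ℂ] E).singularValues
  have h1 : σ k * ∑ i, ‖c i‖ ^ 2 ≤ (inner ℂ (P c) (X (Q c))).re := by
    have : X (Q c) = ∑ i, (c i * (σ i : ℂ)) • u i := by
      change (X : E →ₗ[ℂ] E) (Q c) = _
      simp only [Q, Fintype.linearCombination_apply, map_sum, map_smul, hX, smul_smul]
      rfl
    rw [this]
    change _ ≤ (inner ℂ (∑ i, c i • u i) _).re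
    rw [hu.inner_sum, Finset.mul_sum, Complex.re_sum]
    refine Finset.sum_le_sum fun i _ ↦ ?_
    rw [← mul_assoc, RCLike.conj_mul]
    have : σ k ≤ σ i := LinearMap.singularValues_antitone _ (by omega)
    have h2 : (((‖c i‖ : ℂ)) ^ 2 * (σ i : ℂ)).re = ‖c i‖ ^ 2 * σ i := by
      exact_mod_cast Complex.ofReal_re _
    refine le_trans ?_ h2.ge
    nlinarith [sq_nonneg ‖c i‖]
  have h2 := h (P c) (Q c)
  have h3 : (inner ℂ (L c) (SingularSum.directSum A B (L c))).re =
      (inner ℂ (P c) (A (P c))).re + (inner ℂ (Q c) (B (Q c))).re := by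
    rw [WithLp.prod_inner_apply, Complex.add_re]
    rfl
  have h4 : (inner ℂ (L c) (SingularSum.directSum A B (L c))).re ≤
      ‖L c‖ * ‖SingularSum.directSum A B (L c)‖ :=
    (Complex.re_le_norm _).trans (norm_inner_le_norm _ _)
  have h5 := hL c
  rcases (norm_nonneg (L c)).eq_or_lt with h6 | h6
  · rw [← h6, mul_zero]
    exact norm_nonneg _
  · refine le_of_mul_le_mul_left ?_ h6
    change _ ≤ ‖L c‖ * ‖SingularSum.directSum A B (L c)‖
    nlinarith

/-! ### Functional calculus on finite spectra -/

theorem SemiconjBy.aeval_right {R A : Type*} [CommSemiring R] [Semiring A] [Algebra R A]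
    {x a b : A} (h : SemiconjBy x a b) (p : Polynomial R) :
    SemiconjBy x (Polynomial.aeval a p) (Polynomial.aeval b p) := by
  induction p using Polynomial.induction_on' with
  | add p q hp hq => simpa only [map_add] using hp.add_right hq
  | monomial n r =>
    simp only [Polynomial.aeval_monomial]
    exact SemiconjBy.mul_right (Algebra.commutes r x).symm (h.pow_right n)

/-- A single polynomial interpolates f on both spectra, so f may be arbitrary. -/
theorem SemiconjBy.cfc_right_of_finite {A : Type*} [CStarAlgebra A] {x a b : A}
    (h : SemiconjBy x a b) (f : ℝ → ℝ) (ha : IsSelfAdjoint a) (hb : IsSelfAdjoint b)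
    (hsa : (spectrum ℝ a).Finite) (hsb : (spectrum ℝ b).Finite) :
    SemiconjBy x (cfc f a) (cfc f b) := by
  classical
  set t := hsa.toFinset ∪ hsb.toFinset
  set p := Lagrange.interpolate t id f
  have hp : ∀ r ∈ t, f r = p.eval r := fun r hr ↦
    (Lagrange.eval_interpolate_at_node f Function.injective_id.injOn hr).symm
  have h1 : cfc f a = Polynomial.aeval a p := by
    rw [← cfc_polynomial p a]
    exact cfc_congr fun r hr ↦ hp r (by simp [t, hr])
  have h2 : cfc f b = Polynomial.aeval b p := by
    rw [← cfc_polynomial p b]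
    exact cfc_congr fun r hr ↦ hp r (by simp [t, hr])
  rw [h1, h2]
  exact h.aeval_right p

section

variable {H : Type*} [NormedAddCommGroup H] [InnerProductSpace ℂ H] [FiniteDimensional ℂ H]

theorem ContinuousLinearMap.finite_spectrum (a : H →L[ℂ] H) : (spectrum ℂ a).Finite := by
  let φ : (H →L[ℂ] H) →ₐ[ℂ] Module.End ℂ H :=
    { ContinuousLinearMap.toLinearMapRingHom with commutes' := fun _ ↦ rfl }
  have hφ : Function.Bijective φ :=
    (LinearMap.toContinuousLinearMap (𝕜 := ℂ) (E := H) (F' := H)).symm.bijective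
  rw [← AlgEquiv.spectrum_eq (AlgEquiv.ofBijective φ hφ) a]
  exact Module.End.finite_spectrum (AlgEquiv.ofBijective φ hφ a)

theorem ContinuousLinearMap.finite_spectrum_real (a : H →L[ℂ] H) : (spectrum ℝ a).Finite := by
  rw [← spectrum.preimage_algebraMap (S := ℂ)]
  exact a.finite_spectrum.preimage (algebraMap ℝ ℂ).injective.injOn

theorem ContinuousLinearMap.finite_spectrum_nnreal (a : H →L[ℂ] H) : (spectrum ℝ≥0 a).Finite := by
  rw [← spectrum.preimage_algebraMap (S := ℝ)]
  exact a.finite_spectrum_real.preimage NNReal.coe_injective.injOn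

theorem ContinuousLinearMap.continuousOn_spectrum_nnreal (a : H →L[ℂ] H) (f : ℝ≥0 → ℝ≥0) :
    ContinuousOn f (spectrum ℝ≥0 a) :=
  a.finite_spectrum_nnreal.continuousOn f

variable [CompleteSpace H]

theorem ContinuousLinearMap.mul_cfc_star_mul_self (S : H →L[ℂ] H) (f : ℝ≥0 → ℝ≥0) :
    S * cfc f (star S * S) = cfc f (S * star S) * S := by
  have ha : 0 ≤ star S * S := star_mul_self_nonneg S
  have hb : 0 ≤ S * star S := mul_star_self_nonneg S
  rw [cfc_nnreal_eq_real f _ ha, cfc_nnreal_eq_real f _ hb]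
  exact SemiconjBy.cfc_right_of_finite (mul_assoc S (star S) S).symm _ ha.isSelfAdjoint
    hb.isSelfAdjoint (finite_spectrum_real _) (finite_spectrum_real _)

theorem ContinuousLinearMap.cfc_abs (S : H →L[ℂ] H) (f : ℝ≥0 → ℝ≥0) :
    cfc f (CFC.abs S) = cfc (fun t ↦ f (NNReal.sqrt t)) (star S * S) := by
  rw [CFC.abs, CFC.sqrt_eq_cfc, cfc_comp' f NNReal.sqrt (star S * S)
    ((((star S * S).finite_spectrum_nnreal).image _).continuousOn f)]

/-- Here e is 1 away from 0. The difference D of the two sides satisfies D*D = 0. -/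
theorem ContinuousLinearMap.mul_cfc_eq_self (S : H →L[ℂ] H) {e : ℝ≥0 → ℝ≥0}
    (he : ∀ t, t * e t = t) : S * cfc e (star S * S) = S := by
  set a := star S * S with haS
  have h1 : a * cfc e a = a := by
    conv_rhs => rw [← cfc_id ℝ≥0 a]
    conv_lhs => enter [1]; rw [← cfc_id ℝ≥0 a]
    rw [← cfc_mul _ _ _ (a.continuousOn_spectrum_nnreal _) (a.continuousOn_spectrum_nnreal _)]
    exact cfc_congr fun t _ ↦ he t
  have hs : star (cfc e a) = cfc e a := (cfc_nonneg_of_predicate (a := a)).isSelfAdjoint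
  have h2 : star (S * cfc e a - S) * (S * cfc e a - S) = 0 := by
    have h3 : star S * (S * cfc e a) = a := by rw [← mul_assoc, ← haS, h1]
    rw [star_sub, star_mul, hs, sub_mul, mul_sub, mul_sub, mul_assoc, mul_assoc, h3, ← haS,
      sub_self, sub_self, sub_self]
  exact sub_eq_zero.1 ((CStarRing.star_mul_self_eq_zero_iff _).1 h2)

/-! ### The form inequality and the theorem -/

theorem ContinuousLinearMap.two_mul_re_inner_le_of_mul_eq (S : H →L[ℂ] H) {f g : ℝ≥0 → ℝ≥0}
    (hfg : ∀ t, f t * g t = t) (x y : H) :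
    2 * (inner ℂ x (S y)).re ≤ (inner ℂ x (cfc g (CFC.abs (star S)) x)).re +
      (inner ℂ y ((cfc f (CFC.abs S) * CFC.abs S) y)).re := by
  -- Chosen so that r(|S|²)² = f(|S|)|S|; the argument t stands for |S|².
  let r : ℝ≥0 → ℝ≥0 := fun t ↦ NNReal.sqrt (f (NNReal.sqrt t) * NNReal.sqrt t)
  have hr : ∀ t, r t * r t = f (NNReal.sqrt t) * NNReal.sqrt t := fun t ↦ NNReal.mul_self_sqrt _
  have hr0 : ∀ t, t ≠ 0 → r t ≠ 0 := by
    intro t ht h0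
    have h1 := hr t
    have h2 := hfg (NNReal.sqrt t)
    have h3 : NNReal.sqrt t ≠ 0 := by simpa using ht
    rw [h0, zero_mul, eq_comm, mul_eq_zero_iff_right h3] at h1
    rw [h1, zero_mul] at h2
    exact h3 h2.symm
  set a := star S * S
  set K := cfc r a
  set R := cfc (fun t ↦ (r t)⁻¹) a with hR
  have hKs : star K = K := (cfc_nonneg_of_predicate (a := a)).isSelfAdjoint
  have hRs : star R = R := (cfc_nonneg_of_predicate (a := a)).isSelfAdjoint
  have hKK : K * K = cfc f (CFC.abs S) * CFC.abs S := by
    rw [← cfc_mul _ _ _ (a.continuousOn_spectrum_nnreal _) (a.continuousOn_spectrum_nnreal _),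
      S.cfc_abs, CFC.abs, CFC.sqrt_eq_cfc,
      ← cfc_mul _ _ _ (a.continuousOn_spectrum_nnreal _) (a.continuousOn_spectrum_nnreal _)]
    exact cfc_congr fun t _ ↦ hr t
  have hS : S * R * K = S := by
    rw [mul_assoc,
      ← cfc_mul _ _ _ (a.continuousOn_spectrum_nnreal _) (a.continuousOn_spectrum_nnreal _)]
    refine S.mul_cfc_eq_self fun t ↦ ?_
    rcases eq_or_ne t 0 with rfl | ht
    · simp
    · rw [inv_mul_cancel₀ (hr0 t ht), mul_one]
  have hV : (S * R) * star (S * R) ≤ cfc g (CFC.abs (star S)) := by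
    rw [star_mul, hRs, ← mul_assoc, mul_assoc S R R, hR,
      ← cfc_mul _ _ _ (a.continuousOn_spectrum_nnreal _) (a.continuousOn_spectrum_nnreal _),
      S.mul_cfc_star_mul_self, mul_assoc, (star S).cfc_abs, star_star]
    conv_lhs => enter [2]; rw [← cfc_id ℝ≥0 (S * star S)]
    rw [← cfc_mul _ _ _ (continuousOn_spectrum_nnreal _ _) (continuousOn_spectrum_nnreal _ _)]
    -- Equality holds for t ≠ 0; at t = 0 the left side vanishes while g(0) may be positive.
    refine cfc_mono (fun t _ ↦ ?_) (continuousOn_spectrum_nnreal _ _)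
      (continuousOn_spectrum_nnreal _ _)
    rcases eq_or_ne t 0 with rfl | ht
    · simp
    · have h3 : NNReal.sqrt t ≠ 0 := by simpa using ht
      have h1 := hr0 t ht
      refine le_of_eq ?_
      have h4 : r t * r t * g (NNReal.sqrt t) = t := by
        rw [hr, mul_right_comm, hfg, NNReal.mul_self_sqrt]
      rw [← mul_inv, id, inv_mul_eq_iff_eq_mul₀ (mul_ne_zero h1 h1), h4]
  have hV' : ‖star (S * R) x‖ ^ 2 ≤ (inner ℂ x (cfc g (CFC.abs (star S)) x)).re := by
    have h1 := (ContinuousLinearMap.le_def _ _).1 hV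
    have h2 := h1.re_inner_nonneg_right x
    have h3 : ‖star (S * R) x‖ ^ 2 = (inner ℂ x (((S * R) * star (S * R)) x)).re := by
      rw [mul_apply_eq_comp, ContinuousLinearMap.star_eq_adjoint,
        ← ContinuousLinearMap.adjoint_inner_left]
      exact norm_sq_eq_re_inner (𝕜 := ℂ) _
    rw [sub_apply, inner_sub_right, map_sub] at h2
    rw [h3]
    exact sub_nonneg.1 h2
  have hK' : ‖K y‖ ^ 2 = (inner ℂ y ((cfc f (CFC.abs S) * CFC.abs S) y)).re := by
    rw [← hKK, mul_apply_eq_comp]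
    nth_rw 2 [← hKs]
    rw [ContinuousLinearMap.star_eq_adjoint, ContinuousLinearMap.adjoint_inner_right]
    exact norm_sq_eq_re_inner (𝕜 := ℂ) _
  have h5 : (inner ℂ x (S y)).re ≤ ‖star (S * R) x‖ * ‖K y‖ := by
    conv_lhs => rw [← hS]
    rw [mul_apply_eq_comp, ← ContinuousLinearMap.adjoint_inner_left,
      ← ContinuousLinearMap.star_eq_adjoint]
    exact re_inner_le_norm (𝕜 := ℂ) _ _
  nlinarith [two_mul_le_add_sq ‖star (S * R) x‖ ‖K y‖]

/-- The phase c is absorbed by using cy in place of y for T, which leaves the form of f(|T|)|T|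
unchanged. -/
theorem ContinuousLinearMap.two_mul_re_inner_add_smul_le (S T : H →L[ℂ] H) {f g : ℝ≥0 → ℝ≥0}
    (hfg : ∀ t, f t * g t = t) {c : ℂ} (hc : ‖c‖ = 1) (x y : H) :
    2 * (inner ℂ x ((S + c • T) y)).re ≤
      (inner ℂ x ((cfc g (CFC.abs (star S)) + cfc g (CFC.abs (star T))) x)).re +
      (inner ℂ y ((cfc f (CFC.abs S) * CFC.abs S + cfc f (CFC.abs T) * CFC.abs T) y)).re := by
  have h1 := S.two_mul_re_inner_le_of_mul_eq hfg x y
  have h2 := T.two_mul_re_inner_le_of_mul_eq hfg x (c • y)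
  have h3 : inner ℂ (c • y) ((cfc f (CFC.abs T) * CFC.abs T) (c • y)) =
      inner ℂ y ((cfc f (CFC.abs T) * CFC.abs T) y) := by
    rw [map_smul, inner_smul_left, inner_smul_right, ← mul_assoc, RCLike.conj_mul, hc]
    simp
  rw [h3, map_smul] at h2
  simp only [add_apply, smul_apply, inner_add_right, Complex.add_re]
  linarith

end

/-- Operators on an `n`-dimensional complex Hilbert space `H`. `CFC.abs A` is `|A| = (A⋆ A)^{1/2}`,
and `cfc f |A|` is `f(|A|)`; every `f` is continuous on the spectrum of `|A|`, which is finite. -/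
theorem mainTheorem11 {H : Type*} [NormedAddCommGroup H] [InnerProductSpace ℂ H]
    [CompleteSpace H] [FiniteDimensional ℂ H] (n : ℕ) (hn : Module.finrank ℂ H = n)
    (S T : H →L[ℂ] H) :
    (∀ f g : ℝ≥0 → ℝ≥0, (∀ t, f t * g t = t) → ∀ j ∈ Finset.Icc 1 n,
      SingularSum.s j (S + Complex.I • T) ≤
          SingularSum.s j (SingularSum.directSum
            (cfc g (CFC.abs (star S)) + cfc g (CFC.abs (star T)))
            (cfc f (CFC.abs S) * CFC.abs S + cfc f (CFC.abs T) * CFC.abs T)) ∧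
        SingularSum.s j (S - Complex.I • T) ≤
          SingularSum.s j (SingularSum.directSum
            (cfc g (CFC.abs (star S)) + cfc g (CFC.abs (star T)))
            (cfc f (CFC.abs S) * CFC.abs S + cfc f (CFC.abs T) * CFC.abs T))) ∧
    (∀ j ∈ Finset.Icc 1 n,
      SingularSum.s j (S + Complex.I • T) ≤
          SingularSum.s j (SingularSum.directSum
            (CFC.abs (star S) + CFC.abs (star T)) (CFC.abs S + CFC.abs T)) ∧
        SingularSum.s j (S - Complex.I • T) ≤
          SingularSum.s j (SingularSum.directSum
            (CFC.abs (star S) + CFC.abs (star T)) (CFC.abs S + CFC.abs T))) := by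
  have key : ∀ f g : ℝ≥0 → ℝ≥0, (∀ t, f t * g t = t) → ∀ j : ℕ,
      SingularSum.s j (S + Complex.I • T) ≤
          SingularSum.s j (SingularSum.directSum
            (cfc g (CFC.abs (star S)) + cfc g (CFC.abs (star T)))
            (cfc f (CFC.abs S) * CFC.abs S + cfc f (CFC.abs T) * CFC.abs T)) ∧
        SingularSum.s j (S - Complex.I • T) ≤
          SingularSum.s j (SingularSum.directSum
            (cfc g (CFC.abs (star S)) + cfc g (CFC.abs (star T)))
            (cfc f (CFC.abs S) * CFC.abs S + cfc f (CFC.abs T) * CFC.abs T)) := by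
    refine fun f g hfg j ↦ ⟨SingularSum.s_le_s_directSum
      (S.two_mul_re_inner_add_smul_le T hfg Complex.norm_I) j, ?_⟩
    rw [sub_eq_add_neg, ← neg_smul]
    exact SingularSum.s_le_s_directSum
      (S.two_mul_re_inner_add_smul_le T hfg (by simp)) j
  refine ⟨fun f g hfg j _ ↦ key f g hfg j, fun j _ ↦ ?_⟩
  have h := key (fun _ ↦ 1) id (fun t ↦ one_mul t) j
  simpa only [cfc_id ℝ≥0 _ (CFC.abs_nonneg _), cfc_const_one ℝ≥0 _ (CFC.abs_nonneg _),
    one_mul] using h
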